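/- **Theorem 1.1.** Let $u:(0,\infty)\to\mathbb R$ be the real analytic function $u(t)=\dfrac{t-1}{t\log t}$ (with $u(1)=1$), let $v(t)=\int_0^t \tau\,u(\tau)^2\,d\tau$, and let $n\ge 2$. Write $|\cdot|$ for the Euclidean norm on $\mathbb C^n$ and $\langle X,z\rangle=\sum_{\alpha} X_\alpha\overline{z}_\alpha$. The Grauert metric $g$ on $\mathbb C^n\setminus\{0\}$ is the Kähler metric given, for $z\in\mathbb C^n\setminus\{0\}$ and $X\in\mathbb C^n$, by $$g(z,X)=\sum_{\alpha,\beta}g_{\alpha\overline\beta}(z)X_\alpha\overline{X}_\beta=\left(1+\frac{v(|z|^2)}{|z|^2}\right)|X|^2+\left(u(|z|^2)^2-\frac{v(|z|^2)}{|z|^4}\right)|\langle X,z\rangle|^2 .$$ For $z\in\mathbb C^n\setminus\{0\}$ and $X\in\mathbb C^n\setminus\{0\}$ let $$K_g(z,X)=\frac{2}{g(z,X)^2}\sum_{i,j,k,l}R_{i\overline j k\overline l}(z)\,X_i\overline{X}_jX_k\overline{X}_l,\qquad R_{i\overline jk\overline l}=-\frac{\partial^2 g_{i\overline j}}{\partial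 z_k\partial\overline z_l}+\sum_{p,q}g^{\overline q p}\,\frac{\partial g_{i\overline q}}{\partial z_k}\,\frac{\partial g_{p\overline j}}{\partial\overline z_l},$$ be the holomorphic sectional curvature of $g$ at $z$ along $X$, where $(g^{\overline qp})$ is the inverse of the matrix $(g_{p\overline q})$ (the normalization is such that in complex dimension one this is the Gaussian curvature). Let $K_g^{+}(z)$ and $K_g^{-}(z)$ be the supremum and the infimum of $K_g(z,X)$ over all $X\in\mathbb C^n\setminus\{0\}$. Then $$K_g^{+}(z)\to+\infty\quad\text{as } |z|\to 0,$$ and there exists $R>0$ such that $K_g^{-}(z)<0$ for all $z$ with $|z|\ge R$. -/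

import Mathlib

open Filter Topology

noncomputable section

namespace Grauert

/-! ### Holomorphic sectional curvature of a Hermitian metric on (an open subset of) `ℂⁿ` -/

/-- The Wirtinger derivative `∂f/∂z_k = (∂f/∂x_k - i ∂f/∂y_k) / 2`, with real differentials. -/
def dz {n : ℕ} (k : Fin n) (f : EuclideanSpace ℂ (Fin n) → ℂ) (z : EuclideanSpace ℂ (Fin n)) : ℂ :=
  (fderiv ℝ f z (EuclideanSpace.single k 1)
    - Complex.I * fderiv ℝ f z (EuclideanSpace.single k Complex.I)) / 2

/-- The Wirtinger derivative `∂f/∂z̄_k = (∂f/∂x_k + i ∂f/∂y_k) / 2`. -/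
def dzbar {n : ℕ} (k : Fin n) (f : EuclideanSpace ℂ (Fin n) → ℂ)
    (z : EuclideanSpace ℂ (Fin n)) : ℂ :=
  (fderiv ℝ f z (EuclideanSpace.single k 1)
    + Complex.I * fderiv ℝ f z (EuclideanSpace.single k Complex.I)) / 2

/-- The squared length `g(z, X) = ∑ g_{αβ̄}(z) X_α X̄_β`, where `g z α β` stands for `g_{αβ̄}(z)`. -/
def normSq {n : ℕ} (g : EuclideanSpace ℂ (Fin n) → Matrix (Fin n) (Fin n) ℂ)
    (z X : EuclideanSpace ℂ (Fin n)) : ℝ :=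
  (∑ i, ∑ j, g z i j * X i * star (X j)).re

/-- The components of the curvature tensor of the Chern connection
(the Levi-Civita connection if `g` is Kähler):
`R_{ij̄kl̄} = -∂²g_{ij̄}/∂z_k∂z̄_l + ∑_{p,q} g^{q̄p} (∂g_{iq̄}/∂z_k) (∂g_{pj̄}/∂z̄_l)`,
where `(g^{q̄p})` is the inverse of the matrix `(g_{pq̄})`. -/
def curvature {n : ℕ} (g : EuclideanSpace ℂ (Fin n) → Matrix (Fin n) (Fin n) ℂ)
    (z : EuclideanSpace ℂ (Fin n)) (i j k l : Fin n) : ℂ :=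
  -dz k (fun w => dzbar l (fun w' => g w' i j) w) z
    + ∑ p, ∑ q, (g z)⁻¹ q p * dz k (fun w => g w i q) z * dzbar l (fun w => g w p j) z

/-- The holomorphic sectional curvature `K_g(z, X) = 2 R(X, X̄, X, X̄) / g(z, X)²` for `X ≠ 0`.
The factor `2` is the normalization for which, in dimension one, this is the Gaussian curvature
`-(2 / h) ∂∂̄ log h` of the metric `h |dT|²`. -/
def holSecCurv {n : ℕ} (g : EuclideanSpace ℂ (Fin n) → Matrix (Fin n) (Fin n) ℂ)
    (z X : EuclideanSpace ℂ (Fin n)) : ℝ :=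
  2 * (∑ i, ∑ j, ∑ k, ∑ l,
      curvature g z i j k l * X i * star (X j) * X k * star (X l)).re / normSq g z X ^ 2

/-- `K⁺_g(z)`: the supremum of `K_g(z, X)` over all nonzero tangent vectors `X` at `z`. -/
def maxHolSecCurv {n : ℕ} (g : EuclideanSpace ℂ (Fin n) → Matrix (Fin n) (Fin n) ℂ)
    (z : EuclideanSpace ℂ (Fin n)) : ℝ :=
  sSup {c : ℝ | ∃ X : EuclideanSpace ℂ (Fin n), X ≠ 0 ∧ c = holSecCurv g z X}

/-- `K⁻_g(z)`: the infimum of `K_g(z, X)` over all nonzero tangent vectors `X` at `z`. -/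
def minHolSecCurv {n : ℕ} (g : EuclideanSpace ℂ (Fin n) → Matrix (Fin n) (Fin n) ℂ)
    (z : EuclideanSpace ℂ (Fin n)) : ℝ :=
  sInf {c : ℝ | ∃ X : EuclideanSpace ℂ (Fin n), X ≠ 0 ∧ c = holSecCurv g z X}

/-! ### The Grauert metric -/

/-- The real analytic function `u(t) = (t - 1) / (t log t)` on `(0, ∞)`;
its removable singularity at `t = 1` is filled in by the value `1`. -/
def u (t : ℝ) : ℝ :=
  if t = 1 then 1 else (t - 1) / (t * Real.log t)

/-- `v(t) = ∫₀ᵗ τ u(τ)² dτ`. -/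
def v (t : ℝ) : ℝ :=
  ∫ τ in (0 : ℝ)..t, τ * u τ ^ 2

/-- The Grauert metric on `ℂⁿ ∖ {0}`:
`g_{αβ̄}(z) = (1 + v(|z|²)/|z|²) δ_{αβ} + (u(|z|²)² - v(|z|²)/|z|⁴) z̄_α z_β`. -/
def metric (n : ℕ) (z : EuclideanSpace ℂ (Fin n)) : Matrix (Fin n) (Fin n) ℂ :=
  fun i j =>
    ((1 + v (‖z‖ ^ 2) / ‖z‖ ^ 2 : ℝ) : ℂ) * (if i = j then 1 else 0)
      + ((u (‖z‖ ^ 2) ^ 2 - v (‖z‖ ^ 2) / ‖z‖ ^ 4 : ℝ) : ℂ) * (star (z i) * z j)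

end Grauert

end

noncomputable section

namespace Grauert

/-! With t = |z|², the metric is a(t)δ_{ij} + b(t) z̄_i z_j, and v' = tu² gives a' = b, the Kähler
condition. For X orthogonal to z, which exists since n ≥ 2, the term of the curvature quadratic in
first derivatives drops out. Only two second-derivative terms survive, so K = -4b/a²
(`holSecCurv_radialMetric`): everything is decided by b = (t²u² - v)/t².

Near 0, v behaves like 1/|log t| and t²u² like 1/log² t, so -4b/a² grows at least like |log t|/4
(`tendsto_coeff_ratio`). For large t, t²u² - v has derivative at least 1, so b is eventually
positive (`eventually_coeffB_pos`).

To compare these values with the real `sSup` and `sInf`, the curvatures at a point must be bounded;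
this holds because g dominates the Euclidean metric (`sq_norm_le_normSq_metric`). -/

variable {n : ℕ}

/-! ### Wirtinger calculus -/

/-- The real differential of `f` at `z` is `∑ (p k dz_k + q k dz̄_k)`. -/
def HasWirtinger (f : EuclideanSpace ℂ (Fin n) → ℂ) (p q : Fin n → ℂ)
    (z : EuclideanSpace ℂ (Fin n)) : Prop :=
  ∃ f' : EuclideanSpace ℂ (Fin n) →L[ℝ] ℂ, HasFDerivAt f f' z ∧
    ∀ w, f' w = ∑ k, (p k * w k + q k * star (w k))

namespace HasWirtinger

variable {f g : EuclideanSpace ℂ (Fin n) → ℂ} {p q r s : Fin n → ℂ}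
  {z : EuclideanSpace ℂ (Fin n)}

theorem fderiv_single (h : HasWirtinger f p q z) (k : Fin n) (c : ℂ) :
    fderiv ℝ f z (EuclideanSpace.single k c) = p k * c + q k * star c := by
  obtain ⟨f', hf, h'⟩ := h
  rw [hf.fderiv, h', Finset.sum_eq_single k]
  · simp
  · intro j _ hj
    simp [hj]
  · simp

theorem dz_eq (h : HasWirtinger f p q z) (k : Fin n) : dz k f z = p k := by
  rw [dz, h.fderiv_single, h.fderiv_single]
  simp only [star_one, Complex.star_def, Complex.conj_I]
  linear_combination (-(p k - q k) / 2) * Complex.I_mul_I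

theorem dzbar_eq (h : HasWirtinger f p q z) (k : Fin n) : dzbar k f z = q k := by
  rw [dzbar, h.fderiv_single, h.fderiv_single]
  simp only [star_one, Complex.star_def, Complex.conj_I]
  linear_combination ((p k - q k) / 2) * Complex.I_mul_I

theorem add (hf : HasWirtinger f p q z) (hg : HasWirtinger g r s z) :
    HasWirtinger (fun w => f w + g w) (fun k => p k + r k) (fun k => q k + s k) z := by
  obtain ⟨f', hf, hf'⟩ := hf
  obtain ⟨g', hg, hg'⟩ := hg
  refine ⟨f' + g', hf.add hg, fun w => ?_⟩
  rw [add_apply, hf', hg', ← Finset.sum_add_distrib]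
  exact Finset.sum_congr rfl fun k _ => by ring

theorem mul (hf : HasWirtinger f p q z) (hg : HasWirtinger g r s z) :
    HasWirtinger (fun w => f w * g w) (fun k => f z * r k + g z * p k)
      (fun k => f z * s k + g z * q k) z := by
  obtain ⟨f', hf, hf'⟩ := hf
  obtain ⟨g', hg, hg'⟩ := hg
  refine ⟨_, hf.mul hg, fun w => ?_⟩
  simp only [add_apply, smul_apply, smul_eq_mul]
  rw [hf', hg', Finset.mul_sum, Finset.mul_sum, ← Finset.sum_add_distrib]
  exact Finset.sum_congr rfl fun k _ => by ring

theorem const (c : ℂ) : HasWirtinger (fun _ => c) (fun _ => 0) (fun _ => 0) z :=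
  ⟨0, hasFDerivAt_const c z, fun w => by simp⟩

theorem coord (i : Fin n) :
    HasWirtinger (fun w => w i) (fun k => if k = i then 1 else 0) (fun _ => 0) z :=
  ⟨_, ((EuclideanSpace.proj i : EuclideanSpace ℂ (Fin n) →L[ℂ] ℂ).restrictScalars ℝ).hasFDerivAt,
    fun w => by simp⟩

theorem conj_coord (i : Fin n) :
    HasWirtinger (fun w => star (w i)) (fun _ => 0) (fun k => if k = i then 1 else 0) z :=
  ⟨_, ((Complex.conjCLE : ℂ →L[ℝ] ℂ).comp
    ((EuclideanSpace.proj i : EuclideanSpace ℂ (Fin n) →L[ℂ] ℂ).restrictScalars ℝ)).hasFDerivAt,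
    fun w => by simp⟩

/-- Wirtinger derivatives of a radial function. -/
theorem radial {φ : ℝ → ℝ} {φ' : ℝ} (h : HasDerivAt φ φ' (‖z‖ ^ 2)) :
    HasWirtinger (fun w => (φ (‖w‖ ^ 2) : ℂ)) (fun k => φ' * star (z k)) (fun k => φ' * z k) z := by
  have h1 := (hasStrictFDerivAt_norm_sq (F := EuclideanSpace ℂ (Fin n)) z).hasFDerivAt
  refine ⟨_, Complex.ofRealCLM.hasFDerivAt.comp z (h.comp_hasFDerivAt z h1), fun w => ?_⟩
  have h2 : ∀ x y : ℂ, ((inner ℝ x y : ℝ) : ℂ) = (star x * y + x * star y) / 2 := by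
    intro x y
    apply Complex.ext <;> simp [Complex.inner] <;> ring
  have h3 : ((inner ℝ z w : ℝ) : ℂ) = ∑ k, (star (z k) * w k + z k * star (w k)) / 2 := by
    rw [PiLp.inner_apply, Complex.ofReal_sum]
    exact Finset.sum_congr rfl fun k _ => h2 _ _
  have h4 : Complex.ofRealCLM (φ' * (2 * inner ℝ z w)) = 2 * φ' * ((inner ℝ z w : ℝ) : ℂ) := by
    simp only [Complex.ofRealCLM_apply, Complex.ofReal_mul, Complex.ofReal_ofNat]
    ring
  refine Eq.trans ?_ (h4.trans ?_)
  · simp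
  · rw [h3, Finset.mul_sum]
    exact Finset.sum_congr rfl fun k _ => by ring

theorem congr (h : HasWirtinger f p q z) (hp : ∀ k, p k = r k) (hq : ∀ k, q k = s k) :
    HasWirtinger f r s z := by
  rwa [← funext hp, ← funext hq]

theorem congr_of_eventuallyEq (h : HasWirtinger f p q z) (hfg : g =ᶠ[𝓝 z] f) :
    HasWirtinger g p q z := by
  obtain ⟨f', hf, hf'⟩ := h
  exact ⟨f', hf.congr_of_eventuallyEq hfg, hf'⟩

end HasWirtinger

/-! ### Curvature of radial metrics -/

/-- The metric with components `a(|z|²) δ_{ij} + b(|z|²) z̄_i z_j`. -/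
def radialMetric (a b : ℝ → ℝ) (z : EuclideanSpace ℂ (Fin n)) : Matrix (Fin n) (Fin n) ℂ :=
  fun i j => (a (‖z‖ ^ 2) : ℂ) * (if i = j then 1 else 0) + (b (‖z‖ ^ 2) : ℂ) * (star (z i) * z j)

/-- Having b as the derivative of a makes the ∂_k coefficients symmetric in i and k: this is the
Kähler condition. -/
theorem radialMetric_hasWirtinger {a b : ℝ → ℝ} {c : ℝ} {z : EuclideanSpace ℂ (Fin n)}
    (ha : HasDerivAt a (b (‖z‖ ^ 2)) (‖z‖ ^ 2)) (hb : HasDerivAt b c (‖z‖ ^ 2)) (i j : Fin n) :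
    HasWirtinger (fun w => radialMetric a b w i j)
      (fun k => b (‖z‖ ^ 2) * star (z k) * (if i = j then 1 else 0)
        + c * star (z k) * star (z i) * z j + b (‖z‖ ^ 2) * star (z i) * (if k = j then 1 else 0))
      (fun l => b (‖z‖ ^ 2) * z l * (if i = j then 1 else 0)
        + c * z l * star (z i) * z j + b (‖z‖ ^ 2) * (if l = i then 1 else 0) * z j) z := by
  have h := ((HasWirtinger.radial ha).mul (HasWirtinger.const (if i = j then 1 else 0))).add
    ((HasWirtinger.radial hb).mul ((HasWirtinger.conj_coord i).mul (HasWirtinger.coord j)))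
  exact h.congr (fun k => by ring) (fun k => by ring)

theorem dz_dzbar_radialMetric {a b c : ℝ → ℝ} {d : ℝ} {z : EuclideanSpace ℂ (Fin n)}
    (ha : ∀ᶠ t in 𝓝 (‖z‖ ^ 2), HasDerivAt a (b t) t)
    (hb : ∀ᶠ t in 𝓝 (‖z‖ ^ 2), HasDerivAt b (c t) t) (hc : HasDerivAt c d (‖z‖ ^ 2))
    (i j k l : Fin n) :
    dz k (fun w => dzbar l (fun w' => radialMetric a b w' i j) w) z =
      c (‖z‖ ^ 2) * star (z k) * z l * (if i = j then 1 else 0)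
      + b (‖z‖ ^ 2) * (if k = l then 1 else 0) * (if i = j then 1 else 0)
      + d * star (z k) * z l * star (z i) * z j
      + c (‖z‖ ^ 2) * (if k = l then 1 else 0) * star (z i) * z j
      + c (‖z‖ ^ 2) * z l * star (z i) * (if k = j then 1 else 0)
      + c (‖z‖ ^ 2) * star (z k) * (if l = i then 1 else 0) * z j
      + b (‖z‖ ^ 2) * (if l = i then 1 else 0) * (if k = j then 1 else 0) := by
  have hcont : Tendsto (fun w : EuclideanSpace ℂ (Fin n) => ‖w‖ ^ 2) (𝓝 z) (𝓝 (‖z‖ ^ 2)) :=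
    (continuous_norm.pow 2).continuousAt
  have hE : (fun w => dzbar l (fun w' => radialMetric a b w' i j) w) =ᶠ[𝓝 z]
      fun w => ((b (‖w‖ ^ 2) : ℂ) * w l) * (if i = j then 1 else 0)
        + (((c (‖w‖ ^ 2) : ℂ) * w l) * star (w i)) * w j
        + ((b (‖w‖ ^ 2) : ℂ) * (if l = i then 1 else 0)) * w j := by
    filter_upwards [hcont.eventually ha, hcont.eventually hb] with w h1 h2
    exact (radialMetric_hasWirtinger h1 h2 i j).dzbar_eq l
  have hB := HasWirtinger.radial hb.self_of_nhds
  have hC := HasWirtinger.radial hc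
  have h := (((hB.mul (HasWirtinger.coord l)).mul
    (HasWirtinger.const (if i = j then 1 else 0))).add
    (((hC.mul (HasWirtinger.coord l)).mul (HasWirtinger.conj_coord i)).mul
      (HasWirtinger.coord j))).add
    ((hB.mul (HasWirtinger.const (if l = i then 1 else 0))).mul (HasWirtinger.coord j))
  rw [(h.congr_of_eventuallyEq hE).dz_eq k]
  ring

/-- The curvature of a radial metric in a direction orthogonal to the position vector. -/
theorem sum_curvature_radialMetric {a b c : ℝ → ℝ} {d : ℝ} {z X : EuclideanSpace ℂ (Fin n)}
    (ha : ∀ᶠ t in 𝓝 (‖z‖ ^ 2), HasDerivAt a (b t) t)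
    (hb : ∀ᶠ t in 𝓝 (‖z‖ ^ 2), HasDerivAt b (c t) t) (hc : HasDerivAt c d (‖z‖ ^ 2))
    (hX : ∑ i, X i * star (z i) = 0) :
    ∑ i, ∑ j, ∑ k, ∑ l,
      curvature (radialMetric a b) z i j k l * X i * star (X j) * X k * star (X l) =
      -2 * b (‖z‖ ^ 2) * (∑ i, X i * star (X i)) ^ 2 := by
  have hX' : ∑ i, star (X i) * z i = 0 := by
    simpa [mul_comm] using congrArg star hX
  have hsecond : ∀ j l, ∑ i, ∑ k, (∑ p, ∑ q, ((radialMetric a b z)⁻¹ q p *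
      dz k (fun w => radialMetric a b w i q) z *
      dzbar l (fun w => radialMetric a b w p j) z)) * X i * X k = 0 := by
    intro j l
    -- Each term of ∂_k g_{iq̄} carries z̄_i or z̄_k and dies against X_i X_k, so the inverse matrix
    -- is never computed.
    have h1 : ∀ q, ∑ i, ∑ k, dz k (fun w => radialMetric a b w i q) z * X i * X k = 0 := by
      intro q
      have h2 : ∀ i k, dz k (fun w => radialMetric a b w i q) z * X i * X k =
          (b (‖z‖ ^ 2) * (if i = q then 1 else 0) * X i) * (X k * star (z k))
          + (c (‖z‖ ^ 2) * z q * star (z i) * X i) * (X k * star (z k))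
          + (X i * star (z i)) * (b (‖z‖ ^ 2) * (if k = q then 1 else 0) * X k) := by
        intro i k
        rw [(radialMetric_hasWirtinger ha.self_of_nhds hb.self_of_nhds i q).dz_eq k]
        ring
      simp only [h2, Finset.sum_add_distrib, ← Finset.mul_sum, hX, mul_zero, zero_add]
      rw [← Finset.sum_mul, hX, zero_mul]
    calc _ = ∑ p, ∑ q, ((radialMetric a b z)⁻¹ q p *
          dzbar l (fun w => radialMetric a b w p j) z) *
          ∑ i, ∑ k, dz k (fun w => radialMetric a b w i q) z * X i * X k := by
          simp only [Finset.sum_mul, Finset.mul_sum]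
          rw [Finset.sum_congr rfl fun i _ => Finset.sum_comm, Finset.sum_comm]
          refine Finset.sum_congr rfl fun p _ => ?_
          rw [Finset.sum_congr rfl fun i _ => Finset.sum_comm, Finset.sum_comm]
          refine Finset.sum_congr rfl fun q _ => Finset.sum_congr rfl fun i _ =>
            Finset.sum_congr rfl fun k _ => by ring
      _ = 0 := by simp [h1]
  have hfirst : ∀ i k, ∑ j, ∑ l, dz k (fun w => dzbar l (fun w' => radialMetric a b w' i j) w) z *
      X i * star (X j) * X k * star (X l) =
      2 * b (‖z‖ ^ 2) * (X i * star (X i)) * (X k * star (X k)) := by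
    intro i k
    -- Grouped so that every term except the last two shows a factor X̄_j z_j or X̄_l z_l, which
    -- sums to zero.
    have h2 : ∀ j l, dz k (fun w => dzbar l (fun w' => radialMetric a b w' i j) w) z *
        X i * star (X j) * X k * star (X l) = X i * X k *
        ((c (‖z‖ ^ 2) * star (z k) * (star (X j) * (if i = j then 1 else 0))
            + d * star (z k) * star (z i) * (star (X j) * z j)
            + c (‖z‖ ^ 2) * star (z i) * (star (X j) * (if k = j then 1 else 0)))
            * (star (X l) * z l)
          + (star (X j) * z j) * (c (‖z‖ ^ 2) * star (z i) * (star (X l) * (if k = l then 1 else 0))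
              + c (‖z‖ ^ 2) * star (z k) * (star (X l) * (if l = i then 1 else 0)))
          + b (‖z‖ ^ 2) * (star (X j) * (if i = j then 1 else 0)) *
              (star (X l) * (if k = l then 1 else 0))
          + b (‖z‖ ^ 2) * (star (X j) * (if k = j then 1 else 0)) *
              (star (X l) * (if l = i then 1 else 0))) := by
      intro j l
      rw [dz_dzbar_radialMetric ha hb hc]
      ring
    simp only [h2, ← Finset.mul_sum, Finset.sum_add_distrib, ← Finset.sum_mul, hX', mul_zero,
      zero_mul, zero_add]
    simp
    ring
  have hswap : ∀ F : Fin n → Fin n → Fin n → Fin n → ℂ,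
      ∑ i, ∑ j, ∑ k, ∑ l, F i j k l = ∑ i, ∑ k, ∑ j, ∑ l, F i j k l := fun F =>
    Finset.sum_congr rfl fun i _ => Finset.sum_comm
  have hswap' : ∀ F : Fin n → Fin n → Fin n → Fin n → ℂ,
      ∑ i, ∑ j, ∑ k, ∑ l, F i j k l = ∑ j, ∑ l, ∑ i, ∑ k, F i j k l := fun F => by
    rw [Finset.sum_comm]
    refine Finset.sum_congr rfl fun j _ => ?_
    rw [Finset.sum_congr rfl fun i _ => Finset.sum_comm, Finset.sum_comm]
  simp only [curvature, add_mul, neg_mul, Finset.sum_add_distrib, Finset.sum_neg_distrib]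
  refine (congrArg₂ (fun x y => -x + y) ((hswap _).trans (Finset.sum_congr rfl fun i _ =>
    Finset.sum_congr rfl fun k _ => hfirst i k)) (hswap' _)).trans ?_
  have h3 : ∀ j l i k, (∑ p, ∑ q, ((radialMetric a b z)⁻¹ q p *
      dz k (fun w => radialMetric a b w i q) z *
      dzbar l (fun w => radialMetric a b w p j) z)) * X i * star (X j) * X k * star (X l) =
      (star (X j) * star (X l)) * ((∑ p, ∑ q, ((radialMetric a b z)⁻¹ q p *
      dz k (fun w => radialMetric a b w i q) z *
      dzbar l (fun w => radialMetric a b w p j) z)) * X i * X k) := by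
    intro j l i k
    ring
  simp only [h3, ← Finset.mul_sum, hsecond, mul_zero, Finset.sum_const_zero, add_zero]
  simp only [← Finset.sum_mul, ← Finset.mul_sum]
  ring

theorem normSq_radialMetric (a b : ℝ → ℝ) (z X : EuclideanSpace ℂ (Fin n)) :
    normSq (radialMetric a b) z X =
      a (‖z‖ ^ 2) * ‖X‖ ^ 2 + b (‖z‖ ^ 2) * ‖∑ i, X i * star (z i)‖ ^ 2 := by
  have h : ∑ i, ∑ j, radialMetric a b z i j * X i * star (X j) =
      (a (‖z‖ ^ 2) : ℂ) * ∑ i, X i * star (X i) +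
      b (‖z‖ ^ 2) * ((∑ i, X i * star (z i)) * star (∑ i, X i * star (z i))) := by
    have h1 : ∀ i j, radialMetric a b z i j * X i * star (X j) =
        a (‖z‖ ^ 2) * X i * (star (X j) * (if i = j then 1 else 0)) +
        b (‖z‖ ^ 2) * ((X i * star (z i)) * (star (X j) * z j)) := by
      intro i j
      rw [radialMetric]
      ring
    simp only [h1, Finset.sum_add_distrib, ← Finset.mul_sum, ← Finset.sum_mul]
    simp [Finset.mul_sum, mul_assoc]
  have hn : ∑ i, X i * star (X i) = ((‖X‖ ^ 2 : ℝ) : ℂ) := by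
    rw [EuclideanSpace.norm_sq_eq]
    push_cast
    exact Finset.sum_congr rfl fun i _ => Complex.mul_conj' _
  rw [normSq, h, hn, Complex.star_def, Complex.mul_conj']
  norm_cast

theorem holSecCurv_radialMetric {a b c : ℝ → ℝ} {d : ℝ} {z X : EuclideanSpace ℂ (Fin n)}
    (ha : ∀ᶠ t in 𝓝 (‖z‖ ^ 2), HasDerivAt a (b t) t)
    (hb : ∀ᶠ t in 𝓝 (‖z‖ ^ 2), HasDerivAt b (c t) t) (hc : HasDerivAt c d (‖z‖ ^ 2))
    (hX : ∑ i, X i * star (z i) = 0) (hX0 : X ≠ 0) :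
    holSecCurv (radialMetric a b) z X = -4 * b (‖z‖ ^ 2) / a (‖z‖ ^ 2) ^ 2 := by
  have hn : ∑ i, X i * star (X i) = ((‖X‖ ^ 2 : ℝ) : ℂ) := by
    rw [EuclideanSpace.norm_sq_eq]
    push_cast
    exact Finset.sum_congr rfl fun i _ => Complex.mul_conj' _
  have hr : (-2 * (b (‖z‖ ^ 2) : ℂ) * ((‖X‖ ^ 2 : ℝ) : ℂ) ^ 2).re =
      -2 * b (‖z‖ ^ 2) * (‖X‖ ^ 2) ^ 2 := by norm_cast
  rw [holSecCurv, sum_curvature_radialMetric ha hb hc hX, normSq_radialMetric, hX, hn, hr]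
  have : ‖X‖ ≠ 0 := norm_ne_zero_iff.mpr hX0
  rw [norm_zero]
  have h4 : (a (‖z‖ ^ 2) * ‖X‖ ^ 2 + b (‖z‖ ^ 2) * 0 ^ 2) ^ 2 = a (‖z‖ ^ 2) ^ 2 * (‖X‖ ^ 2) ^ 2 := by
    ring
  rw [h4, show 2 * (-2 * b (‖z‖ ^ 2) * (‖X‖ ^ 2) ^ 2) = (-4 * b (‖z‖ ^ 2)) * (‖X‖ ^ 2) ^ 2 by ring]
  exact mul_div_mul_right _ _ (by positivity)

/-! ### Boundedness of the curvature, and orthogonal vectors -/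

/-- Holomorphic sectional curvatures are bounded where the metric dominates the Euclidean one. -/
theorem abs_holSecCurv_le (g : EuclideanSpace ℂ (Fin n) → Matrix (Fin n) (Fin n) ℂ)
    {z : EuclideanSpace ℂ (Fin n)} (h : ∀ X, ‖X‖ ^ 2 ≤ normSq g z X)
    {X : EuclideanSpace ℂ (Fin n)} (hX : X ≠ 0) :
    |holSecCurv g z X| ≤ 2 * ∑ i, ∑ j, ∑ k, ∑ l, ‖curvature g z i j k l‖ := by
  have hpos : 0 < ‖X‖ := norm_pos_iff.mpr hX
  have hx : ∀ i, ‖X i‖ ≤ ‖X‖ := fun i => PiLp.norm_apply_le X i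
  have hg : (‖X‖ ^ 2) ^ 2 ≤ normSq g z X ^ 2 := pow_le_pow_left₀ (by positivity) (h X) 2
  have hnum : |(∑ i, ∑ j, ∑ k, ∑ l,
      curvature g z i j k l * X i * star (X j) * X k * star (X l)).re| ≤
      (∑ i, ∑ j, ∑ k, ∑ l, ‖curvature g z i j k l‖) * (‖X‖ ^ 2) ^ 2 := by
    refine (Complex.abs_re_le_norm _).trans ?_
    simp only [Finset.sum_mul]
    refine norm_sum_le_of_le _ fun i _ => norm_sum_le_of_le _ fun j _ =>
      norm_sum_le_of_le _ fun k _ => norm_sum_le_of_le _ fun l _ => ?_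
    simp only [norm_mul, norm_star]
    calc _ ≤ ‖curvature g z i j k l‖ * ‖X‖ * ‖X‖ * ‖X‖ * ‖X‖ := by
          gcongr <;> apply hx
      _ = _ := by ring
  rw [holSecCurv, abs_div, abs_mul, abs_of_nonneg (sq_nonneg (normSq g z X)),
    abs_of_pos (two_pos : (0 : ℝ) < 2)]
  refine div_le_of_le_mul₀ (sq_nonneg _) (by positivity) ?_
  rw [mul_assoc]
  gcongr
  exact hnum.trans (by gcongr)

/-- The bound matters: `sSup` of a real set unbounded above is 0. -/
theorem holSecCurv_le_max (g : EuclideanSpace ℂ (Fin n) → Matrix (Fin n) (Fin n) ℂ)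
    {z : EuclideanSpace ℂ (Fin n)} (h : ∀ X, ‖X‖ ^ 2 ≤ normSq g z X)
    {X : EuclideanSpace ℂ (Fin n)} (hX : X ≠ 0) : holSecCurv g z X ≤ maxHolSecCurv g z := by
  refine le_csSup ⟨2 * ∑ i, ∑ j, ∑ k, ∑ l, ‖curvature g z i j k l‖, ?_⟩ ⟨X, hX, rfl⟩
  rintro _ ⟨Y, hY, rfl⟩
  exact (abs_le.mp (abs_holSecCurv_le g h hY)).2

theorem min_le_holSecCurv (g : EuclideanSpace ℂ (Fin n) → Matrix (Fin n) (Fin n) ℂ)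
    {z : EuclideanSpace ℂ (Fin n)} (h : ∀ X, ‖X‖ ^ 2 ≤ normSq g z X)
    {X : EuclideanSpace ℂ (Fin n)} (hX : X ≠ 0) : minHolSecCurv g z ≤ holSecCurv g z X := by
  refine csInf_le ⟨-(2 * ∑ i, ∑ j, ∑ k, ∑ l, ‖curvature g z i j k l‖), ?_⟩ ⟨X, hX, rfl⟩
  rintro _ ⟨Y, hY, rfl⟩
  exact (abs_le.mp (abs_holSecCurv_le g h hY)).1

theorem exists_ne_zero_orthogonal (hn : 2 ≤ n) (z : EuclideanSpace ℂ (Fin n)) :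
    ∃ X : EuclideanSpace ℂ (Fin n), X ≠ 0 ∧ ∑ i, X i * star (z i) = 0 := by
  let i₀ : Fin n := ⟨0, by omega⟩
  let i₁ : Fin n := ⟨1, by omega⟩
  have hne : i₁ ≠ i₀ := by simp [i₀, i₁]
  -- The vector z̄₁e₀ - z̄₀e₁ is visibly nonzero only when z₁ ≠ 0; otherwise e₁ itself is orthogonal
  -- to z.
  by_cases h : z i₁ = 0
  · refine ⟨EuclideanSpace.single i₁ 1, by simp, ?_⟩
    rw [Finset.sum_eq_single i₁ (fun j _ hj => by simp [hj]) (by simp), h]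
    simp
  · refine ⟨EuclideanSpace.single i₀ (star (z i₁)) - EuclideanSpace.single i₁ (star (z i₀)),
      fun h0 => h ?_, ?_⟩
    · simpa [hne.symm] using congrArg (fun Y : EuclideanSpace ℂ (Fin n) => Y i₀) h0
    · have h1 : ∀ (i : Fin n) (c : ℂ), ∑ k, EuclideanSpace.single i c k * star (z k) =
          c * star (z i) := fun i c => by
        rw [Finset.sum_eq_single i (fun j _ hj => by simp [hj]) (by simp)]
        simp
      simp only [PiLp.sub_apply, sub_mul, Finset.sum_sub_distrib, h1]
      ring

/-! ### Regularity and bounds for u and v -/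

/-- The divided difference of log at 1 removes the singularity, giving continuity of u across t = 1.
-/
theorem u_eq_inv_dslope (t : ℝ) : u t = (t * dslope Real.log 1 t)⁻¹ := by
  by_cases h : t = 1
  · simp [u, h, dslope_same]
  · rw [u, if_neg h, dslope_of_ne _ h, slope_def_field, Real.log_one, sub_zero, mul_div_assoc',
      inv_div]

theorem dslope_log_ne_zero {t : ℝ} (ht : 0 < t) : dslope Real.log 1 t ≠ 0 := by
  by_cases h : t = 1
  · simp [h, dslope_same]
  · rw [dslope_of_ne _ h, slope_def_field, Real.log_one, sub_zero]
    exact div_ne_zero (Real.log_ne_zero_of_pos_of_ne_one ht h) (sub_ne_zero.mpr h)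

theorem continuousAt_u {t : ℝ} (ht : 0 < t) : ContinuousAt u t := by
  have h : ContinuousAt (dslope Real.log 1) t := by
    by_cases h1 : t = 1
    · rw [h1, continuousAt_dslope_same]
      exact Real.differentiableAt_log one_ne_zero
    · exact (continuousAt_dslope_of_ne h1).mpr (Real.continuousAt_log ht.ne')
  rw [funext u_eq_inv_dslope]
  exact (continuousAt_id.mul h).inv₀ (mul_ne_zero ht.ne' (dslope_log_ne_zero ht))

/-- Compares v' with the exact derivative of -1/log t. At t = 1 it fails, since division by zero
makes the right side 0. -/
theorem density_eq {t : ℝ} (ht0 : t ≠ 0) (ht1 : t ≠ 1) :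
    t * u t ^ 2 = (1 - t) ^ 2 * (t⁻¹ / Real.log t ^ 2) := by
  rw [u, if_neg ht1]
  by_cases hl : Real.log t = 0
  · simp [hl]
  · field_simp
    ring

theorem hasDerivAt_neg_inv_log {t : ℝ} (ht0 : 0 < t) (ht1 : t ≠ 1) :
    HasDerivAt (fun s => -(Real.log s)⁻¹) (t⁻¹ / Real.log t ^ 2) t := by
  have := ((Real.hasDerivAt_log ht0.ne').inv (Real.log_ne_zero_of_pos_of_ne_one ht0 ht1)).neg
  exact this.congr_deriv (by ring)

/-- The conventions log 0 = 0 and 0⁻¹ = 0 agree with the limit at 0⁺, so the fundamental theorem of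
calculus applies from 0. -/
theorem continuousOn_neg_inv_log {t : ℝ} (ht1 : t < 1) :
    ContinuousOn (fun s => -(Real.log s)⁻¹) (Set.Icc 0 t) := by
  intro s hs
  rcases hs.1.eq_or_lt with h | h
  · subst h
    refine (continuousWithinAt_sdiff_self).mp ?_
    have : Tendsto (fun s => -(Real.log s)⁻¹) (𝓝[>] 0) (𝓝 (-0)) :=
      (tendsto_inv_atBot_zero.comp Real.tendsto_log_nhdsGT_zero).neg
    simp only [ContinuousWithinAt, Real.log_zero, inv_zero]
    refine this.mono_left (nhdsWithin_mono _ fun x hx => ?_)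
    exact lt_of_le_of_ne hx.1.1 (Ne.symm hx.2)
  · exact (hasDerivAt_neg_inv_log h (by linarith [hs.2])).continuousAt.continuousWithinAt

theorem intervalIntegrable_log_density {t : ℝ} (ht0 : 0 < t) (ht1 : t < 1) :
    IntervalIntegrable (fun s => s⁻¹ / Real.log s ^ 2) MeasureTheory.volume 0 t := by
  rw [intervalIntegrable_iff_integrableOn_Ioc_of_le ht0.le]
  exact intervalIntegral.integrableOn_deriv_of_nonneg (continuousOn_neg_inv_log ht1)
    (fun s hs => hasDerivAt_neg_inv_log hs.1 (by linarith [hs.2]))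
    (fun s hs => by have := hs.1; positivity)

theorem integral_log_density {t : ℝ} (ht0 : 0 < t) (ht1 : t < 1) :
    ∫ s in (0 : ℝ)..t, s⁻¹ / Real.log s ^ 2 = -(Real.log t)⁻¹ := by
  rw [intervalIntegral.integral_eq_sub_of_hasDerivAt_of_le ht0.le (continuousOn_neg_inv_log ht1)
    (fun s hs => hasDerivAt_neg_inv_log hs.1 (by linarith [hs.2]))
    (intervalIntegrable_log_density ht0 ht1)]
  simp

theorem density_eqOn {t : ℝ} (ht0 : 0 < t) (ht1 : t < 1) :
    Set.EqOn (fun s => (1 - s) ^ 2 * (s⁻¹ / Real.log s ^ 2)) (fun s => s * u s ^ 2)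
      (Set.uIoc 0 t) := by
  intro s hs
  rw [Set.uIoc_of_le ht0.le] at hs
  exact (density_eq hs.1.ne' (by linarith [hs.2])).symm

theorem intervalIntegrable_density {t : ℝ} (ht : 0 < t) :
    IntervalIntegrable (fun s => s * u s ^ 2) MeasureTheory.volume 0 t := by
  have h1 : IntervalIntegrable (fun s => s * u s ^ 2) MeasureTheory.volume 0 (1 / 2) := by
    refine (IntervalIntegrable.congr (density_eqOn (by norm_num) (by norm_num))) ?_
    exact (intervalIntegrable_log_density (by norm_num) (by norm_num)).continuousOn_mul
      (by fun_prop)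
  -- Past 1/2 only continuity of u on (0, ∞) is needed, including at 1.
  refine h1.trans (ContinuousOn.intervalIntegrable fun s hs => ?_)
  have hs0 : 0 < s := (lt_min (by norm_num) ht).trans_le hs.1
  exact (continuousAt_id.mul ((continuousAt_u hs0).pow 2)).continuousWithinAt

theorem hasDerivAt_v {t : ℝ} (ht : 0 < t) : HasDerivAt v (t * u t ^ 2) t := by
  refine intervalIntegral.integral_hasDerivAt_right (intervalIntegrable_density ht) ?_
    (continuousAt_id.mul ((continuousAt_u ht).pow 2))
  refine ContinuousOn.stronglyMeasurableAtFilter isOpen_Ioi (fun s hs => ?_) t (Set.mem_Ioi.mpr ht)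
  exact (continuousAt_id.mul ((continuousAt_u hs).pow 2)).continuousWithinAt

theorem v_nonneg {t : ℝ} (ht : 0 < t) : 0 ≤ v t :=
  intervalIntegral.integral_nonneg ht.le fun _ hs => mul_nonneg hs.1 (sq_nonneg _)

theorem v_le {t : ℝ} (ht0 : 0 < t) (ht1 : t < 1) : v t ≤ -(Real.log t)⁻¹ := by
  rw [← integral_log_density ht0 ht1, v]
  refine intervalIntegral.integral_mono_on ht0.le (intervalIntegrable_density ht0)
    (intervalIntegrable_log_density ht0 ht1) fun s hs => ?_
  rcases hs.1.eq_or_lt with h | h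
  · simp [← h]
  · rw [density_eq h.ne' (by linarith [hs.2])]
    exact mul_le_of_le_one_left (by positivity) (by nlinarith [hs.2])

theorem le_v {t : ℝ} (ht0 : 0 < t) (ht1 : t < 1) : (1 - t) ^ 2 * -(Real.log t)⁻¹ ≤ v t := by
  rw [← integral_log_density ht0 ht1, v, ← intervalIntegral.integral_const_mul]
  refine intervalIntegral.integral_mono_on ht0.le
    ((intervalIntegrable_log_density ht0 ht1).const_mul _) (intervalIntegrable_density ht0)
    fun s hs => ?_
  rcases hs.1.eq_or_lt with h | h
  · simp [← h]
  · rw [density_eq h.ne' (by linarith [hs.2])]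
    have : (1 - t) ^ 2 ≤ (1 - s) ^ 2 := pow_le_pow_left₀ (by linarith) (by linarith [hs.2]) 2
    gcongr

/-- Excluding t = 1 costs nothing: only small and large t are used. -/
theorem contDiffOn_u : ContDiffOn ℝ 3 u (Set.Ioi 0 \ {1}) := by
  have h : ContDiffOn ℝ 3 (fun t => (t - 1) / (t * Real.log t)) (Set.Ioi 0 \ {1}) := by
    refine (contDiffOn_id.sub contDiffOn_const).div
      (contDiffOn_id.mul (contDiffOn_id.log fun t ht => (Set.mem_Ioi.mp ht.1).ne')) fun t ht => ?_
    exact mul_ne_zero (Set.mem_Ioi.mp ht.1).ne' (Real.log_ne_zero_of_pos_of_ne_one ht.1 ht.2)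
  exact h.congr fun t ht => if_neg ht.2

theorem isOpen_Ioi_diff_one : IsOpen (Set.Ioi (0 : ℝ) \ {1}) :=
  isOpen_Ioi.sdiff isClosed_singleton

theorem contDiffOn_v : ContDiffOn ℝ 3 v (Set.Ioi 0 \ {1}) := by
  rw [show (3 : WithTop ℕ∞) = 2 + 1 by norm_num,
    contDiffOn_succ_iff_deriv_of_isOpen isOpen_Ioi_diff_one]
  refine ⟨fun t ht => (hasDerivAt_v ht.1).differentiableAt.differentiableWithinAt,
    by simp, ?_⟩
  have h : ContDiffOn ℝ 2 (fun t => t * u t ^ 2) (Set.Ioi 0 \ {1}) :=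
    contDiffOn_id.mul ((contDiffOn_u.of_le (by norm_num)).pow 2)
  exact h.congr fun t ht => (hasDerivAt_v ht.1).deriv

/-! ### Coefficients of the Grauert metric and their asymptotics -/

/-- The first coefficient `1 + v(t)/t` of the Grauert metric. -/
def coeffA (t : ℝ) : ℝ := 1 + v t / t

/-- The second coefficient `u(t)² - v(t)/t²` of the Grauert metric. -/
def coeffB (t : ℝ) : ℝ := u t ^ 2 - v t / t ^ 2

theorem hasDerivAt_coeffA {t : ℝ} (ht : 0 < t) : HasDerivAt coeffA (coeffB t) t := by
  refine (((hasDerivAt_v ht).div (hasDerivAt_id t) ht.ne').const_add 1).congr_deriv ?_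
  have := ht.ne'
  simp only [coeffB, id]
  field_simp

theorem contDiffOn_coeffB : ContDiffOn ℝ 3 coeffB (Set.Ioi 0 \ {1}) :=
  (contDiffOn_u.pow 2).sub (contDiffOn_v.div (contDiffOn_id.pow 2) fun _ ht =>
    pow_ne_zero 2 (Set.mem_Ioi.mp ht.1).ne')

theorem hasDerivAt_coeffB {t : ℝ} (ht0 : 0 < t) (ht1 : t ≠ 1) :
    HasDerivAt coeffB (deriv coeffB t) t :=
  ((contDiffOn_coeffB.contDiffAt (isOpen_Ioi_diff_one.mem_nhds ⟨ht0, ht1⟩)).differentiableAt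
    (by norm_num)).hasDerivAt

theorem hasDerivAt_deriv_coeffB {t : ℝ} (ht0 : 0 < t) (ht1 : t ≠ 1) :
    HasDerivAt (deriv coeffB) (deriv (deriv coeffB) t) t := by
  have h : ContDiffOn ℝ 2 (deriv coeffB) (Set.Ioi 0 \ {1}) :=
    contDiffOn_coeffB.deriv_of_isOpen isOpen_Ioi_diff_one (by norm_num)
  exact ((h.contDiffAt (isOpen_Ioi_diff_one.mem_nhds ⟨ht0, ht1⟩)).differentiableAt
    (by norm_num)).hasDerivAt

theorem one_le_coeffA {t : ℝ} (ht : 0 < t) : 1 ≤ coeffA t :=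
  le_add_of_nonneg_right (div_nonneg (v_nonneg ht) ht.le)

/-- This is the eigenvalue of g along z; v cancels and leaves 1 + tu². -/
theorem one_le_coeffA_add {t : ℝ} (ht : 0 < t) : 1 ≤ coeffA t + coeffB t * t := by
  have h : coeffA t + coeffB t * t = 1 + t * u t ^ 2 := by
    have := ht.ne'
    rw [coeffA, coeffB]
    field_simp
    ring
  rw [h]
  exact le_add_of_nonneg_right (by positivity)

/-- With L = -log t, the ratio is 4(v - t²u²)/(t + v)². The bounds v ≥ 1/(4L), t²u² ≤ 1/L² and t + v
≤ 2/L make it at least L/4 - 1. -/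
theorem tendsto_coeff_ratio :
    Tendsto (fun t => -4 * coeffB t / coeffA t ^ 2) (𝓝[>] 0) atTop := by
  have hlog : Tendsto (fun t => -Real.log t) (𝓝[>] 0) atTop :=
    tendsto_neg_atBot_atTop.comp Real.tendsto_log_nhdsGT_zero
  have hsmall : Tendsto (fun t => t * Real.log t) (𝓝[>] 0) (𝓝 0) := by
    simpa using Real.continuous_mul_log.continuousAt.tendsto.mono_left
      (nhdsWithin_le_nhds (a := (0 : ℝ)) (s := Set.Ioi 0))
  have hlow : Tendsto (fun t => -Real.log t * (1 / 4) + (-1)) (𝓝[>] 0) atTop :=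
    tendsto_atTop_add_const_right _ _ (hlog.atTop_mul_const (by norm_num))
  refine tendsto_atTop_mono' _ ?_ hlow
  filter_upwards [self_mem_nhdsWithin, hlog.eventually_ge_atTop 4,
    hsmall.eventually (lt_mem_nhds (show (-1 : ℝ) < 0 by norm_num)),
    nhdsWithin_le_nhds (gt_mem_nhds (show (0 : ℝ) < 1 / 2 by norm_num))] with t ht h4 h1 h2
  have ht : 0 < t := ht
  have hv1 := v_le ht (by linarith)
  have hv2 := le_v ht (by linarith)
  have hv0 := v_nonneg ht
  have hL : 0 < -Real.log t := neg_pos.mpr (Real.log_neg ht (by linarith))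
  rw [← inv_neg] at hv1 hv2
  have hu : t ^ 2 * u t ^ 2 = (1 - t) ^ 2 * (-Real.log t)⁻¹ ^ 2 := by
    have := density_eq ht.ne' (show t ≠ 1 by linarith)
    rw [pow_two t, mul_assoc, this, inv_neg]
    have := ht.ne'
    field_simp
  have e : -4 * coeffB t / coeffA t ^ 2 = 4 * (v t - t ^ 2 * u t ^ 2) / (t + v t) ^ 2 := by
    have := ht.ne'
    have : t + v t ≠ 0 := by positivity
    rw [coeffA, coeffB]
    field_simp
    ring
  set L := -Real.log t with hLdef
  have hi : 0 < L⁻¹ := inv_pos.mpr hL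
  have hLL : L * L⁻¹ = 1 := mul_inv_cancel₀ hL.ne'
  have ht' : t ≤ L⁻¹ := by
    rw [← one_div, le_div_iff₀ hL]
    rw [hLdef]
    linarith
  have hq1 : 1 / 4 ≤ (1 - t) ^ 2 := by nlinarith
  have hq2 : (1 - t) ^ 2 ≤ 1 := by nlinarith
  rw [e, hu, le_div_iff₀ (by positivity)]
  have hden : (t + v t) ^ 2 ≤ 4 * L⁻¹ ^ 2 := by
    calc (t + v t) ^ 2 ≤ (2 * L⁻¹) ^ 2 := by gcongr; linarith
      _ = _ := by ring
  have hpos : 0 ≤ L * (1 / 4) + -1 := by linarith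
  calc (L * (1 / 4) + -1) * (t + v t) ^ 2 ≤ (L * (1 / 4) + -1) * (4 * L⁻¹ ^ 2) := by gcongr
    _ = 4 * (1 / 4 * L⁻¹ - L⁻¹ ^ 2) := by linear_combination L⁻¹ * hLL
    _ ≤ 4 * (v t - (1 - t) ^ 2 * L⁻¹ ^ 2) := by
      gcongr
      · nlinarith
      · exact mul_le_of_le_one_left (by positivity) hq2

theorem eventually_coeffB_pos : ∀ᶠ t in atTop, 0 < coeffB t := by
  have hlog : ∀ᶠ t : ℝ in atTop, Real.log t ^ 2 ≤ 1 / 4 * t := by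
    have h := (Real.isLittleO_pow_log_id_atTop (n := 2)).bound (show (0 : ℝ) < 1 / 4 by norm_num)
    filter_upwards [h, eventually_gt_atTop 0] with t ht h0
    simpa [abs_of_pos h0] using ht
  have hlog4 : ∀ᶠ t : ℝ in atTop, 4 ≤ Real.log t := Real.tendsto_log_atTop.eventually_ge_atTop 4
  obtain ⟨T, hT⟩ := (hlog.and (hlog4.and (eventually_ge_atTop 2))).exists_forall_of_atTop
  have hT2 : 2 ≤ T := (hT T le_rfl).2.2
  -- D = t²b for large t.
  let D : ℝ → ℝ := fun t => (t - 1) ^ 2 / Real.log t ^ 2 - v t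
  have hD : ∀ t, T ≤ t → HasDerivAt D ((t - 1) / (t * Real.log t ^ 2) *
      (t + 1 - 2 * (t - 1) / Real.log t)) t := by
    intro t ht
    obtain ⟨_, h4, h2⟩ := hT t ht
    have ht0 : t ≠ 0 := by linarith
    have hl : Real.log t ≠ 0 := by linarith
    refine (((((hasDerivAt_id t).sub_const 1).pow 2).div ((Real.hasDerivAt_log ht0).pow 2)
      (pow_ne_zero 2 hl)).sub (hasDerivAt_v (by linarith))).congr_deriv ?_
    rw [density_eq ht0 (by linarith)]
    simp only [id, Pi.pow_apply]
    field_simp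
    ring
  -- D' ≥ (2/t)(t/2) = 1: the first factor uses log² t ≤ t/4 and t ≥ 2, the second log t ≥ 4.
  have hmono : MonotoneOn (fun t => D t - t) (Set.Ici T) := by
    refine monotoneOn_of_hasDerivWithinAt_nonneg (convex_Ici T)
      (fun t ht => ((hD t ht).sub (hasDerivAt_id t)).continuousAt.continuousWithinAt)
      (fun t ht => ((hD t (interior_subset ht)).sub (hasDerivAt_id t)).hasDerivWithinAt)
      fun t ht => ?_
    obtain ⟨h1, h4, h2⟩ := hT t (interior_subset ht)
    have hb : t / 2 ≤ t + 1 - 2 * (t - 1) / Real.log t := by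
      have : 2 * (t - 1) / Real.log t ≤ t / 2 := by
        rw [div_le_iff₀ (by linarith)]
        nlinarith
      linarith
    have hl : 0 < Real.log t := by linarith
    have hc : 2 / t ≤ (t - 1) / (t * Real.log t ^ 2) := by
      rw [div_le_div_iff₀ (by linarith) (by positivity)]
      nlinarith
    have : 1 ≤ (t - 1) / (t * Real.log t ^ 2) * (t + 1 - 2 * (t - 1) / Real.log t) := by
      calc (1 : ℝ) = 2 / t * (t / 2) := by field_simp
        _ ≤ _ := mul_le_mul hc hb (by linarith) (le_trans (by positivity) hc)
    linarith
  filter_upwards [eventually_ge_atTop T, eventually_gt_atTop (T - D T)] with t ht h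
  have h1 := hmono Set.self_mem_Ici ht ht
  have hDt : 0 < D t := by
    simp only at h1
    linarith
  obtain ⟨_, h4, h2⟩ := hT t ht
  have hB : coeffB t = D t / t ^ 2 := by
    have : Real.log t ≠ 0 := by linarith
    have : t ≠ 0 := by linarith
    rw [coeffB, u, if_neg (by linarith)]
    simp only [D]
    field_simp
  rw [hB]
  have : 0 < t := by linarith
  positivity

/-! ### Application to the Grauert metric -/

theorem metric_eq_radialMetric : metric n = radialMetric coeffA coeffB := by
  funext z i j
  rw [metric, radialMetric, coeffA, coeffB, ← pow_mul]

theorem sq_norm_le_normSq_metric {z : EuclideanSpace ℂ (Fin n)} (hz : z ≠ 0)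
    (X : EuclideanSpace ℂ (Fin n)) : ‖X‖ ^ 2 ≤ normSq (metric n) z X := by
  have ht : 0 < ‖z‖ ^ 2 := by positivity
  have hcs : ‖∑ i, X i * star (z i)‖ ^ 2 ≤ ‖X‖ ^ 2 * ‖z‖ ^ 2 := by
    have h := norm_inner_le_norm (𝕜 := ℂ) z X
    rw [PiLp.inner_apply] at h
    calc ‖∑ i, X i * star (z i)‖ ^ 2 ≤ (‖z‖ * ‖X‖) ^ 2 := pow_le_pow_left₀ (norm_nonneg _) h 2
      _ = _ := by ring
  rw [metric_eq_radialMetric, normSq_radialMetric]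
  have h1 := one_le_coeffA ht
  have h2 := one_le_coeffA_add ht
  -- If b ≥ 0, a ≥ 1 suffices; if b < 0, Cauchy–Schwarz reduces the claim to a + tb ≥ 1.
  rcases le_or_gt 0 (coeffB (‖z‖ ^ 2)) with hb | hb
  · nlinarith [mul_nonneg hb (sq_nonneg ‖∑ i, X i * star (z i)‖), sq_nonneg ‖X‖]
  · nlinarith [mul_le_mul_of_nonpos_left hcs hb.le, sq_nonneg ‖X‖]

theorem holSecCurv_metric_of_orthogonal {z X : EuclideanSpace ℂ (Fin n)} (hz : z ≠ 0)
    (hz1 : ‖z‖ ^ 2 ≠ 1) (hX : ∑ i, X i * star (z i) = 0) (hX0 : X ≠ 0) :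
    holSecCurv (metric n) z X = -4 * coeffB (‖z‖ ^ 2) / coeffA (‖z‖ ^ 2) ^ 2 := by
  have ht : 0 < ‖z‖ ^ 2 := by positivity
  rw [metric_eq_radialMetric]
  refine holSecCurv_radialMetric (c := deriv coeffB) ?_ ?_ (hasDerivAt_deriv_coeffB ht hz1) hX hX0
  · filter_upwards [lt_mem_nhds ht] with t h using hasDerivAt_coeffA h
  · filter_upwards [lt_mem_nhds ht, isOpen_ne.mem_nhds hz1] with t h h1 using
      hasDerivAt_coeffB h h1

end Grauert

end

theorem theorem1p1 (n : ℕ) (hn : 2 ≤ n) :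
    Tendsto (fun z : EuclideanSpace ℂ (Fin n) => Grauert.maxHolSecCurv (Grauert.metric n) z)
      (𝓝[≠] 0) atTop ∧
    ∃ R : ℝ, 0 < R ∧ ∀ z : EuclideanSpace ℂ (Fin n), R ≤ ‖z‖ →
      Grauert.minHolSecCurv (Grauert.metric n) z < 0 := by
  constructor
  · have hnorm : Tendsto (fun z : EuclideanSpace ℂ (Fin n) => ‖z‖ ^ 2) (𝓝[≠] 0) (𝓝[>] 0) := by
      refine tendsto_nhdsWithin_iff.mpr ⟨?_, ?_⟩
      · have h : Continuous fun z : EuclideanSpace ℂ (Fin n) => ‖z‖ ^ 2 := by fun_prop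
        simpa using h.continuousAt.tendsto.mono_left
          (nhdsWithin_le_nhds (a := (0 : EuclideanSpace ℂ (Fin n))) (s := {0}ᶜ))
      · filter_upwards [self_mem_nhdsWithin] with z hz
        have : z ≠ 0 := hz
        exact Set.mem_Ioi.mpr (by positivity)
    refine tendsto_atTop_mono' _ ?_ (Grauert.tendsto_coeff_ratio.comp hnorm)
    filter_upwards [self_mem_nhdsWithin, hnorm.eventually
      (nhdsWithin_le_nhds (gt_mem_nhds (zero_lt_one' ℝ)))] with z hz h1
    obtain ⟨X, hX0, hX⟩ := Grauert.exists_ne_zero_orthogonal hn z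
    rw [Function.comp_apply, ← Grauert.holSecCurv_metric_of_orthogonal hz h1.ne hX hX0]
    exact Grauert.holSecCurv_le_max _ (Grauert.sq_norm_le_normSq_metric hz) hX0
  · obtain ⟨T, hT⟩ := Grauert.eventually_coeffB_pos.exists_forall_of_atTop
    -- The 2 ensures |z|² ≥ |z| ≥ T and |z|² ≠ 1.
    refine ⟨max T 2, by positivity, fun z hz => ?_⟩
    have hz2 : 2 ≤ ‖z‖ := (le_max_right _ _).trans hz
    have hz0 : z ≠ 0 := norm_pos_iff.mp (by linarith)
    have ht : T ≤ ‖z‖ ^ 2 := by nlinarith [(le_max_left T 2).trans hz]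
    obtain ⟨X, hX0, hX⟩ := Grauert.exists_ne_zero_orthogonal hn z
    refine (Grauert.min_le_holSecCurv _ (Grauert.sq_norm_le_normSq_metric hz0) hX0).trans_lt ?_
    rw [Grauert.holSecCurv_metric_of_orthogonal hz0 (by nlinarith) hX hX0]
    have hA := Grauert.one_le_coeffA (show 0 < ‖z‖ ^ 2 by positivity)
    have hB := hT _ ht
    exact div_neg_of_neg_of_pos (by linarith) (by positivity)
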